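/- Theorem. A one-stage, simultaneous-move federated learning privacy game (FLPG) consists of finitely many players $1,\dots,K$, exactly one of whom is the attacker and the others defenders; a nonempty strategy set $S_k\subseteq\mathbb{R}$ for each player $k$, with $S_k\subseteq[0,D]$ (protection extents) for a defender and $S_k\subseteq[0,1/\epsilon]$ (attacking extents) for the attacker, where $D,\epsilon>0$; and, supplied by an oracle, real lower and upper bounds $\underline U_k(s)\le\overline U_k(s)$ for the unknown payoff of each player $k$ at each profile $s\in S=S_1\times\dots\times S_K$. A robust operator $\Psi$ assigns a real number to every interval of possible payoffs (for instance the infimum, or the mean of the uniform distribution). The robust payoff of player $k$ is $r_k(s)=\Psi\big([\underline U_k(s),\overline U_k(s)]\big)$. For every FLPG and every robust operator $\Psi$ the following hold. 1. Suppose that every $S_k$ is closed and convex (for instance the whole interval $[0,D]$ or $[0,1/\epsilon]$), that every $r_k$ is continuous on $S$, and that every $r_k$ is concave in player $k$'s own strategy $s_k\in S_k$ for each fixed $s_{-k}$. Then there is a robust Nash equilibrium: a profile $s^*\in S$ such that $r_k(s_k^*,s_{-k}^*)\ge r_k(s_k,s_{-k}^*)$ for all $k$ and all $s_k\in S_k$.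 2. Suppose that every $S_k$ is finite, that the oracle also gives a correlation probability matrix, i.e. a probability distribution $P_o$ on $S$, and that for each $k$ the uncertainty set $\{u:S\to\mathbb{R} : \underline U_k\le u\le\overline U_k\}$ of the payoff of player $k$ is bounded. The oracle draws $s$ from $P_o$ and suggests $s_k$ privately to player $k$, who, independently of the other players, follows with probability $p_k^y(s_k)\in[0,1]$ and otherwise, with probability $p_k^n(s_k)=1-p_k^y(s_k)$, plays a given candidate strategy $c_k(s_k)\in S_k$, where the maps $c_k:S_k\to S_k$ are arbitrary. Put $$\gamma_k(p_1^y,\dots,p_K^y)=\sum_{s\in S}P_o(s)\sum_{t\in\{y,n\}^K}\Big(\prod_{j=1}^K p_j^{t_j}(s_j)\Big)\,r_k(s'),\qquad s'_j=\begin{cases}s_j,&t_j=y,\\ c_j(s_j),&t_j=n.\end{cases}$$ Then there is a robust and correlated equilibrium: vectors $p_k^{*,y}\in[0,1]^{S_k}$ such that $\gamma_k(p_k^{*,y},p_{-k}^{*,y})\ge\gamma_k(q_k,p_{-k}^{*,y})$ for all $k$ and all $q_k\in[0,1]^{S_k}$. -/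

import Mathlib

open MeasureTheory

noncomputable section

/-- A one-stage, simultaneous-move federated learning privacy game with player set `Fin K`: one
player is the semi-honest attacker, the others are defenders. A strategy of a defender is a
protection extent in `[0, D]`, a strategy of the attacker is an attacking extent in `[0, 1 / ε]`.
The true payoffs are unknown; the oracle supplies a lower and an upper bound for the payoff of each
player at each strategy profile. (Values of `lower` and `upper` outside the set of strategy
profiles are never used.) -/
structure FLPG (K : ℕ) where
  /-- the semi-honest attacker -/
  attacker : Fin K
  /-- the largest possible protection extent -/
  D : ℝ
  D_pos : 0 < D
  /-- the largest possible attacking extent is `1 / ε` -/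
  ε : ℝ
  ε_pos : 0 < ε
  /-- the strategy sets -/
  strategy : Fin K → Set ℝ
  strategy_nonempty : ∀ k, (strategy k).Nonempty
  strategy_attacker : strategy attacker ⊆ Set.Icc 0 (1 / ε)
  strategy_defender : ∀ k, k ≠ attacker → strategy k ⊆ Set.Icc 0 D
  /-- the lower bounds of the payoffs -/
  lower : Fin K → (Fin K → ℝ) → ℝ
  /-- the upper bounds of the payoffs -/
  upper : Fin K → (Fin K → ℝ) → ℝ
  lower_le_upper : ∀ k, ∀ s ∈ Set.univ.pi strategy, lower k s ≤ upper k s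

/-- A robust operator condenses an interval of possible payoffs to one number, for instance
`worstCase` or `averageCase` below. No property of the operator is assumed. -/
abbrev RobustOperator : Type := Set ℝ → ℝ

/-- The infimum operator. -/
def worstCase : RobustOperator := fun I => sInf I

open Classical in
/-- The expectation with respect to the uniform distribution on an interval, which for a one-point
interval is its point. -/
def averageCase : RobustOperator := fun I => if volume I = 0 then sInf I else ⨍ x in I, x

theorem worstCase_Icc {a b : ℝ} (h : a ≤ b) : worstCase (Set.Icc a b) = a :=
  csInf_Icc h

theorem averageCase_Icc {a b : ℝ} (h : a ≤ b) : averageCase (Set.Icc a b) = (a + b) / 2 := by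
  rcases h.eq_or_lt with rfl | h
  · simp [averageCase]
  · have hv : volume (Set.Icc a b) ≠ 0 := by simp [h]
    have h0 : b - a ≠ 0 := (sub_pos.2 h).ne'
    rw [averageCase, if_neg hv, setAverage_eq, integral_Icc_eq_integral_Ioc,
      ← intervalIntegral.integral_of_le h.le, integral_id, measureReal_def, Real.volume_Icc,
      ENNReal.toReal_ofReal (sub_pos.2 h).le, smul_eq_mul]
    field_simp
    ring

namespace FLPG

variable {K : ℕ} (G : FLPG K)

/-- The set of strategy profiles, as a set of real vectors. -/
def profiles : Set (Fin K → ℝ) := Set.univ.pi G.strategy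

/-- The strategy profiles, as a type. -/
abbrev Profile : Type := ∀ k, G.strategy k

/-- The robust payoff of player `k` at a strategy profile. -/
def robustPayoff (Ψ : RobustOperator) (k : Fin K) (s : Fin K → ℝ) : ℝ :=
  Ψ (Set.Icc (G.lower k s) (G.upper k s))

/-- A robust (Nash) equilibrium: no player can raise the robust payoff by a unilateral change of
strategy. -/
def IsRobustEquilibrium (Ψ : RobustOperator) (s : Fin K → ℝ) : Prop :=
  s ∈ G.profiles ∧ ∀ k, ∀ x ∈ G.strategy k,
    G.robustPayoff Ψ k (Function.update s k x) ≤ G.robustPayoff Ψ k s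

/-- The uncertainty set of the payoff of player `k`: all payoff functions between the bounds. -/
def uncertaintySet (k : Fin K) : Set (G.Profile → ℝ) :=
  {u | ∀ s : G.Profile, u s ∈ Set.Icc (G.lower k fun j => s j) (G.upper k fun j => s j)}

/-- The uncertainty set of the payoff of player `k` is bounded. -/
def BoundedUncertainty (k : Fin K) : Prop :=
  ∃ M : ℝ, ∀ u ∈ G.uncertaintySet k, ∀ s, |u s| ≤ M

/-- The following probabilities: `p k s` is the probability that player `k` follows the suggestion
of the oracle if the oracle suggests `s` to player `k`. -/
abbrev FollowProbs : Type := ∀ k, G.strategy k → ℝ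

variable {G} in
/-- The profile that is played if the oracle suggests `s` and the answers of the players are `t`
(`t j = true` if player `j` follows): a player who does not follow plays the candidate strategy,
which may depend on the suggestion that the player received. -/
def played (candidate : ∀ k, G.strategy k → G.strategy k) (t : Fin K → Bool) (s : G.Profile) :
    G.Profile :=
  fun j => if t j then s j else candidate j (s j)

variable {G} in
/-- The probability that the players, who decide independently, answer `t` to the suggestions
`s`. -/
def answerProb (p : G.FollowProbs) (t : Fin K → Bool) (s : G.Profile) : ℝ :=
  ∏ j, if t j then p j (s j) else 1 - p j (s j)

/-- The robust payoff of player `k` under the following probabilities `p`, if the oracle draws the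
suggested profile from the joint distribution `Po`: the mean of the robust payoff at the profile
that is played. -/
def correlatedPayoff [∀ k, Fintype (G.strategy k)] (Ψ : RobustOperator) (Po : G.Profile → ℝ)
    (candidate : ∀ k, G.strategy k → G.strategy k) (k : Fin K) (p : G.FollowProbs) : ℝ :=
  ∑ s : G.Profile, Po s * ∑ t : Fin K → Bool,
    answerProb p t s * G.robustPayoff Ψ k fun j => played candidate t s j

/-- A robust and correlated equilibrium: no player can raise the robust payoff by a unilateral
change of the vector of following probabilities. -/
def IsRobustCorrelatedEquilibrium [∀ k, Fintype (G.strategy k)] (Ψ : RobustOperator)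
    (Po : G.Profile → ℝ) (candidate : ∀ k, G.strategy k → G.strategy k)
    (p : G.FollowProbs) : Prop :=
  (∀ k s, p k s ∈ Set.Icc (0 : ℝ) 1) ∧
    ∀ k, ∀ q : G.strategy k → ℝ, (∀ s, q s ∈ Set.Icc (0 : ℝ) 1) →
      G.correlatedPayoff Ψ Po candidate k (Function.update p k q) ≤
        G.correlatedPayoff Ψ Po candidate k p

end FLPG

end

/-! Both parts are Nash existence for payoffs that are continuous and concave in one's own strategy,
on a box (`exists_equilibrium_of_concaveOn`). If no profile is an equilibrium, the summed unilateral
gains `F x y` are positive for some `y` at each `x`. Concavity makes these `y` a convex set, and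
continuity lets one `y` serve all nearby `x`, so a continuous selection exists. Brouwer gives it a
fixed point, yet `F x x = 0`.

Brouwer follows from the absence of a smooth retraction onto the sphere, by a volume argument: `∫
det (1 + t • h')` equals the volume of the ball for small `t`, hence at `t = 1` because it is
polynomial in `t`; for a retraction that integral vanishes.

For correlated equilibria, each pair (player, suggestion) acts as a separate agent choosing a number
in `[0, 1]`. -/

/-! ### Brouwer's fixed point theorem. -/

section Brouwer

open Set Metric Polynomial
open scoped RealInnerProductSpace

/-- Extrapolation of polynomials of bounded degree from small positive arguments. -/
theorem exists_extrapolation (n : ℕ) {δ : ℝ} (hδ : 0 < δ) :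
    ∃ c τ : ℕ → ℝ, (∀ i, 0 < τ i ∧ τ i < δ) ∧ ∀ p : ℝ[X], p.natDegree ≤ n →
      p.eval 1 = ∑ i ∈ Finset.range (n + 1), c i * p.eval (τ i) := by
  -- The shift by 2 makes even the node `τ 0` strictly smaller than `δ`.
  set τ : ℕ → ℝ := fun i => δ / (i + 2) with hτ
  have hinj : Function.Injective τ := by
    intro i j hij
    have h1 : (i : ℝ) + 2 ≠ 0 := by positivity
    have h2 : (j : ℝ) + 2 ≠ 0 := by positivity
    simp only [hτ] at hij
    rw [div_eq_div_iff h1 h2] at hij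
    have := mul_left_cancel₀ hδ.ne' hij
    exact_mod_cast (by linarith : (i : ℝ) = j)
  refine ⟨fun i => (Lagrange.basis (Finset.range (n + 1)) τ i).eval 1, τ, fun i => ⟨by positivity,
    div_lt_self hδ (by have : (0 : ℝ) ≤ i := by positivity
                       linarith)⟩, fun p hp => ?_⟩
  have hd : p.degree < (Finset.range (n + 1)).card := by
    rw [Finset.card_range]
    exact lt_of_le_of_lt (degree_le_natDegree) (by exact_mod_cast Nat.lt_succ_of_le hp)
  conv_lhs => rw [Lagrange.eq_interpolate (s := Finset.range (n + 1)) hinj.injOn hd,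
    Lagrange.interpolate_apply, eval_finsetSum]
  simp [mul_comm]

variable {E : Type*}

theorem exists_polynomial_eval_eq_det_one_add_smul [NormedAddCommGroup E] [NormedSpace ℝ E]
    [FiniteDimensional ℝ E] (A : E →L[ℝ] E) :
    ∃ p : ℝ[X], p.natDegree ≤ Module.finrank ℝ E ∧ ∀ t : ℝ, p.eval t = (1 + t • A).det := by
  let b := Module.finBasis ℝ E
  let M := LinearMap.toMatrix b b (A : E →ₗ[ℝ] E)
  refine ⟨Matrix.det ((X : ℝ[X]) • M.map C + (1 : Matrix _ _ ℝ).map C), ?_, fun t => ?_⟩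
  · simpa using natDegree_det_X_add_C_le M 1
  · rw [← coe_evalRingHom, RingHom.map_det, ContinuousLinearMap.det, ← LinearMap.det_toMatrix b]
    have h : LinearMap.toMatrix b b ((1 + t • A : E →L[ℝ] E) : E →ₗ[ℝ] E) = 1 + t • M := by
      rw [← LinearMap.toMatrix_one b, ← map_smul, ← map_add]
      rfl
    rw [h]
    congr 1
    ext i j
    by_cases hij : i = j <;> simp [hij, add_comm, mul_comm t]

/-- Along the path `1 + s • A` from the identity no operator has a kernel, so the determinant cannot
change sign. -/
theorem ContinuousLinearMap.det_one_add_pos [NormedAddCommGroup E] [NormedSpace ℝ E]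
    [FiniteDimensional ℝ E] {A : E →L[ℝ] E} (hA : ‖A‖ < 1) : 0 < (1 + A).det := by
  have hne : ∀ s ∈ Icc (0 : ℝ) 1, (1 + s • A).det ≠ 0 := by
    intro s hs h0
    obtain ⟨v, hv, hv0⟩ := (Submodule.ne_bot_iff _).1
      (LinearMap.bot_lt_ker_of_det_eq_zero (f := ((1 + s • A : E →L[ℝ] E) : E →ₗ[ℝ] E)) h0).ne'
    have h1 : v + s • A v = 0 := by simpa using hv
    have h2 : ‖v‖ = ‖s • A v‖ := by
      conv_lhs => rw [eq_neg_of_add_eq_zero_left h1, norm_neg]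
    have h3 : ‖s • A v‖ ≤ ‖A‖ * ‖v‖ := by
      rw [norm_smul, Real.norm_of_nonneg hs.1]
      nlinarith [A.le_opNorm v, hs.1, hs.2, norm_nonneg (A v)]
    nlinarith [norm_pos_iff.2 hv0]
  by_contra! hle
  have hc : ContinuousOn (fun s : ℝ => (1 + s • A).det) (Icc 0 1) :=
    (ContinuousLinearMap.continuous_det.comp (by fun_prop)).continuousOn
  obtain ⟨s, hs, h0⟩ := intermediate_value_Icc' zero_le_one hc
    (show (0 : ℝ) ∈ Icc _ _ by simpa [ContinuousLinearMap.det] using hle)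
  exact hne s hs h0

/-- A function that is Lipschitz on a closed ball and vanishes on the sphere remains Lipschitz when
it is extended by zero. -/
theorem LipschitzOnWith.indicator_closedBall [NormedAddCommGroup E] [NormedSpace ℝ E] {F : Type*}
    [NormedAddCommGroup F] {h : E → F} {L : NNReal} {R : ℝ}
    (hL : LipschitzOnWith L h (closedBall 0 R)) (h0 : ∀ x, ‖x‖ = R → h x = 0) :
    LipschitzWith L ((closedBall (0 : E) R).indicator h) := by
  have key : ∀ x ∈ closedBall (0 : E) R, ∀ y ∉ closedBall (0 : E) R, ‖h x‖ ≤ L * dist x y := by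
    intro x hx y hy
    -- The segment leaves the ball through a point of the sphere, where `h` vanishes.
    obtain ⟨z, hz, hzR⟩ : ∃ z ∈ segment ℝ x y, ‖z‖ = R :=
      (convex_segment x y).isPreconnected.intermediate_value (left_mem_segment ℝ x y)
        (right_mem_segment ℝ x y) continuous_norm.continuousOn
        ⟨by simpa using hx, by simpa using (not_le.1 (by simpa using hy) : R < ‖y‖).le⟩
    have h1 := hL.dist_le_mul x hx z (by simp [hzR])
    rw [h0 z hzR, dist_zero_right] at h1
    refine h1.trans (mul_le_mul_of_nonneg_left ?_ L.2)
    have := dist_add_dist_of_mem_segment hz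
    linarith [dist_nonneg (x := z) (y := y)]
  refine LipschitzWith.of_dist_le_mul fun x y => ?_
  by_cases hx : x ∈ closedBall (0 : E) R <;> by_cases hy : y ∈ closedBall (0 : E) R
  · simpa [indicator_of_mem, hx, hy] using hL.dist_le_mul x hx y hy
  · simpa [indicator_of_mem hx, indicator_of_notMem hy] using key x hx y hy
  · simpa [indicator_of_mem hy, indicator_of_notMem hx, dist_comm] using key y hy x hx
  · simp only [indicator_of_notMem hx, indicator_of_notMem hy, dist_self]
    positivity

/-- Convexity gives the self-map, and `t * L < 1` makes `t • h` a contraction, hence injectivity.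
Surjectivity is Banach's fixed point theorem for `x ↦ y - t • H x`, with `H` the extension of `h` by
zero: a fixed point outside the ball would equal `y`. -/
theorem bijOn_closedBall_of_lipschitz [NormedAddCommGroup E] [NormedSpace ℝ E] [CompleteSpace E]
    {h : E → E} {L : NNReal} {R t : ℝ} (hL : LipschitzOnWith L h (closedBall 0 R))
    (h0 : ∀ x, ‖x‖ = R → h x = 0) (ht0 : 0 ≤ t) (ht1 : t ≤ 1) (htL : t * L < 1)
    (hm : MapsTo (fun x => x + h x) (closedBall 0 R) (closedBall 0 R)) :
    BijOn (fun x => x + t • h x) (closedBall 0 R) (closedBall 0 R) := by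
  refine ⟨fun x hx => ?_, fun x hx y hy hxy => ?_, fun y hy => ?_⟩
  · have := (convex_closedBall (0 : E) R) hx (hm hx) (sub_nonneg.2 ht1) ht0 (by ring)
    convert this using 1
    simp only [smul_add, sub_smul, one_smul]
    abel
  · have h1 : dist x y = dist (t • h x) (t • h y) := by
      have : x - y = t • h y - t • h x := by
        have hxy' : x + t • h x = y + t • h y := hxy
        rw [sub_eq_sub_iff_add_eq_add, hxy']; abel
      rw [dist_eq_norm, this, dist_comm, dist_eq_norm]
    have h2 : dist (t • h x) (t • h y) ≤ t * L * dist x y := by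
      rw [dist_smul₀, Real.norm_of_nonneg ht0, mul_assoc]
      exact mul_le_mul_of_nonneg_left (hL.dist_le_mul x hx y hy) ht0
    by_contra hne
    nlinarith [dist_pos.2 hne]
  · set H := (closedBall (0 : E) R).indicator h with hH
    have hHL : LipschitzWith L H := hL.indicator_closedBall h0
    have hc : ContractingWith (Real.toNNReal t * L) (fun x => y - t • H x) := by
      have hcoe : ((Real.toNNReal t * L : NNReal) : ℝ) = t * L := by
        rw [NNReal.coe_mul, Real.coe_toNNReal t ht0]
      refine ⟨by rw [← NNReal.coe_lt_coe, hcoe]; exact htL, LipschitzWith.of_dist_le_mul fun a b => ?_⟩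
      rw [dist_sub_left, dist_smul₀, Real.norm_of_nonneg ht0, hcoe, mul_assoc]
      exact mul_le_mul_of_nonneg_left (hHL.dist_le_mul a b) ht0
    have hfix : y - t • H (hc.fixedPoint) = hc.fixedPoint := hc.fixedPoint_isFixedPt
    set x := hc.fixedPoint
    have hx : x ∈ closedBall (0 : E) R := by
      by_contra hx
      rw [hH, indicator_of_notMem hx, smul_zero, sub_zero] at hfix
      exact hx (hfix ▸ hy)
    refine ⟨x, hx, ?_⟩
    rw [hH, indicator_of_mem hx] at hfix
    simp only
    nth_rewrite 1 [← hfix]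
    abel

variable [NormedAddCommGroup E]

/-- For small `t` the map `x + t • h x` is a bijection of the ball with positive Jacobian, so the
change of variables formula gives the volume. The Jacobian is a polynomial in `t`, so extrapolation
carries this to `t = 1`, where bijectivity may fail. -/
theorem integral_det_one_add_eq_volume [NormedSpace ℝ E] [FiniteDimensional ℝ E]
    [MeasurableSpace E] [BorelSpace E] (μ : Measure E) [μ.IsAddHaarMeasure] {h : E → E}
    {h' : E → E →L[ℝ] E} {R : ℝ} (hd : ∀ x ∈ closedBall (0 : E) R, HasFDerivAt h (h' x) x)
    (hc : ContinuousOn h' (closedBall 0 R)) (h0 : ∀ x, ‖x‖ = R → h x = 0)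
    (hm : MapsTo (fun x => x + h x) (closedBall 0 R) (closedBall 0 R)) :
    ∫ x in closedBall 0 R, (1 + h' x).det ∂μ = μ.real (closedBall 0 R) := by
  have hK : IsCompact (closedBall (0 : E) R) := isCompact_closedBall 0 R
  obtain ⟨C, hC⟩ := hK.exists_bound_of_continuousOn hc
  set L : NNReal := Real.toNNReal C with hLdef
  have hbound : ∀ x ∈ closedBall (0 : E) R, ‖h' x‖ ≤ L := fun x hx =>
    (hC x hx).trans (Real.le_coe_toNNReal C)
  have hL : LipschitzOnWith L h (closedBall 0 R) :=
    (convex_closedBall (0 : E) R).lipschitzOnWith_of_nnnorm_hasFDerivWithin_le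
      (fun x hx => (hd x hx).hasFDerivWithinAt) hbound
  have hL1 : (0 : ℝ) < L + 1 := by positivity
  -- The bound `1 / (L + 1)` ensures both `τ i < 1` and `τ i * L < 1`.
  obtain ⟨c, τ, hτ, hp⟩ := exists_extrapolation (Module.finrank ℝ E)
    (show (0 : ℝ) < 1 / (L + 1) by positivity)
  have hdetc : ∀ t : ℝ, ContinuousOn (fun x => (1 + t • h' x).det) (closedBall 0 R) := fun t =>
    ContinuousLinearMap.continuous_det.comp_continuousOn
      (continuousOn_const.add (hc.const_smul t))
  have hsmall : ∀ i, ∫ x in closedBall 0 R, (1 + τ i • h' x).det ∂μ = μ.real (closedBall 0 R) := by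
    intro i
    have ht := (hτ i).1
    have htL : τ i * (L + 1) < 1 := by
      have := (hτ i).2
      rwa [lt_div_iff₀ hL1] at this
    have hb := bijOn_closedBall_of_lipschitz hL h0 ht.le (by nlinarith [L.2]) (by linarith) hm
    have hcv := integral_image_eq_integral_abs_det_fderiv_smul μ (f' := fun x => 1 + τ i • h' x)
      measurableSet_closedBall (fun x hx => ((hasFDerivAt_id x).add
        ((hd x hx).const_smul (τ i))).hasFDerivWithinAt) hb.injOn (fun _ => (1 : ℝ))
    have himg := hb.image_eq
    rw [show (fun x => x + τ i • h x) = (id + τ i • h) from rfl] at himg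
    rw [himg] at hcv
    rw [setIntegral_const, smul_eq_mul, mul_one] at hcv
    rw [hcv]
    refine setIntegral_congr_fun measurableSet_closedBall fun x hx => ?_
    have : 0 < (1 + τ i • h' x).det := ContinuousLinearMap.det_one_add_pos (by
      rw [norm_smul, Real.norm_of_nonneg ht.le]
      nlinarith [hbound x hx])
    simp [abs_of_pos this]
  have hpt : ∀ (A : E →L[ℝ] E), (1 + A).det =
      ∑ i ∈ Finset.range (Module.finrank ℝ E + 1), c i * (1 + τ i • A).det := by
    intro A
    obtain ⟨p, hpd, hpe⟩ := exists_polynomial_eval_eq_det_one_add_smul A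
    have := hp p hpd
    simpa only [hpe, one_smul] using this
  have hsum : ∑ i ∈ Finset.range (Module.finrank ℝ E + 1), c i = 1 := by
    have := hp 1 (by simp)
    simpa using this.symm
  rw [setIntegral_congr_fun measurableSet_closedBall fun x _ => hpt (h' x), integral_finsetSum _ fun i _ =>
    (((hdetc (τ i)).integrableOn_compact hK).const_mul (c i) : _)]
  simp_rw [integral_const_mul, hsmall]
  rw [← Finset.sum_mul, hsum, one_mul]

variable [InnerProductSpace ℝ E] [FiniteDimensional ℝ E]

/-- Since `‖r‖` is constant, `r x` is orthogonal to the range of the derivative, whose determinant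
therefore vanishes; but it should integrate to the volume of the ball. -/
theorem not_exists_smooth_retraction_sphere {r : E → E} {R : ℝ} (hR : 0 < R)
    (hr : ∀ x ∈ closedBall (0 : E) R, ContDiffAt ℝ 1 r x) (hid : ∀ x, ‖x‖ = R → r x = x) :
    ¬ ∀ x ∈ closedBall (0 : E) R, ‖r x‖ = R := by
  intro hs
  borelize E
  let μ : Measure E := Measure.addHaar
  have hd : ∀ x ∈ closedBall (0 : E) R, HasFDerivAt r (fderiv ℝ r x) x := fun x hx =>
    ((hr x hx).differentiableAt one_ne_zero).hasFDerivAt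
  have hc : ContinuousOn (fderiv ℝ r) (closedBall 0 R) := fun x hx =>
    ((hr x hx).fderiv_right (m := 0) (by simp)).continuousAt.continuousWithinAt
  have hvol := integral_det_one_add_eq_volume μ (h := fun x => r x - x)
    (h' := fun x => fderiv ℝ r x - 1) (R := R)
    (fun x hx => (hd x hx).sub (hasFDerivAt_id x)) (hc.sub continuousOn_const)
    (fun x hx => by simp [hid x hx]) (fun x hx => by simp [hs x hx])
  have hzero : ∀ x ∈ ball (0 : E) R, (fderiv ℝ r x).det = 0 := by
    intro x hx
    by_contra hdet
    have hx' := ball_subset_closedBall hx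
    have hsurj : Function.Surjective (fderiv ℝ r x) :=
      (LinearEquiv.ofIsUnitDet (f := (fderiv ℝ r x : E →ₗ[ℝ] E)) (v := Module.finBasis ℝ E)
        (v' := Module.finBasis ℝ E) (by
          rw [LinearMap.det_toMatrix]; exact isUnit_iff_ne_zero.2 hdet)).surjective
    obtain ⟨v, hv⟩ := hsurj (r x)
    have h1 : HasFDerivAt (fun y => ⟪r y, r y⟫) _ x := (hd x hx').inner ℝ (hd x hx')
    have h2 : HasFDerivAt (fun y => ⟪r y, r y⟫) (0 : E →L[ℝ] ℝ) x :=
      (hasFDerivAt_const (R ^ 2) x).congr_of_eventuallyEq (by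
        filter_upwards [isOpen_ball.mem_nhds hx] with y hy
        rw [real_inner_self_eq_norm_sq, hs y (ball_subset_closedBall hy)])
    have h3 := congrArg (fun A : E →L[ℝ] ℝ => A v) (h1.unique h2)
    simp [hv, hs x hx'] at h3
    exact hR.ne' h3
  have hint : ∫ x in closedBall 0 R, (1 + (fderiv ℝ r x - 1)).det ∂μ = 0 := by
    have hae : ball (0 : E) R =ᵐ[μ] closedBall 0 R :=
      ae_eq_of_subset_of_measure_ge ball_subset_closedBall
        (by rw [Measure.addHaar_closedBall μ 0 hR.le, Measure.addHaar_ball_of_pos μ 0 hR])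
        measurableSet_ball.nullMeasurableSet measure_closedBall_lt_top.ne
    rw [← setIntegral_congr_set hae]
    exact setIntegral_eq_zero_of_forall_eq_zero fun x hx => by simpa using hzero x hx
  rw [hint] at hvol
  have : 0 < μ.real (closedBall (0 : E) R) :=
    ENNReal.toReal_pos (measure_closedBall_pos μ 0 hR).ne' measure_closedBall_lt_top.ne
  exact this.ne hvol

/-- Without a fixed point, the ray from `g x` through `x` meets the sphere at `r x`, a smooth
retraction. -/
theorem exists_fixedPoint_of_contDiff {g : E → E} (hg : ContDiff ℝ 1 g) {R : ℝ}
    (hR : ∀ x, ‖g x‖ < R) : ∃ x, g x = x := by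
  by_contra! hne
  have hR0 : 0 < R := (norm_nonneg _).trans_lt (hR 0)
  let v : E → E := fun x => x - g x
  let b : E → ℝ := fun x => ⟪x, v x⟫
  let a : E → ℝ := fun x => ⟪v x, v x⟫
  -- `s x` is the larger root of `‖x + s • v x‖ ^ 2 = R ^ 2`, and `D` is a quarter of its
  -- discriminant. Positivity of `D` keeps the square root smooth; `b > 0` on the sphere gives `s =
  -- 0` there.
  let D : E → ℝ := fun x => b x ^ 2 + a x * (R ^ 2 - ⟪x, x⟫)
  let s : E → ℝ := fun x => (-b x + Real.sqrt (D x)) / a x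
  let r : E → E := fun x => x + s x • v x
  have hv : ContDiff ℝ 1 v := contDiff_id.sub hg
  have hb : ContDiff ℝ 1 b := contDiff_id.inner ℝ hv
  have ha : ContDiff ℝ 1 a := hv.inner ℝ hv
  have hD : ContDiff ℝ 1 D :=
    (hb.pow 2).add (ha.mul (contDiff_const.sub (contDiff_id.inner ℝ contDiff_id)))
  have ha0 : ∀ x, 0 < a x := fun x => real_inner_self_pos.2 (sub_ne_zero.2 (hne x).symm)
  have hb0 : ∀ x, ‖x‖ = R → 0 < b x := by
    intro x hx
    have h1 : b x = ‖x‖ ^ 2 - ⟪x, g x⟫ := by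
      simp only [b, v, inner_sub_right, real_inner_self_eq_norm_sq]
    have h2 := real_inner_le_norm x (g x)
    rw [h1, hx]
    rw [hx] at h2
    nlinarith [hR x]
  have hD0 : ∀ x ∈ closedBall (0 : E) R, 0 < D x := by
    intro x hx
    have hx' : ‖x‖ ≤ R := by simpa using hx
    simp only [D, real_inner_self_eq_norm_sq]
    rcases hx'.lt_or_eq with h | h
    · have : 0 < R ^ 2 - ‖x‖ ^ 2 := by nlinarith [norm_nonneg x]
      have := mul_pos (ha0 x) this
      positivity
    · rw [h, sub_self, mul_zero, add_zero]
      exact pow_pos (hb0 x h) 2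
  refine not_exists_smooth_retraction_sphere (r := r) hR0 (fun x hx => ?_) (fun x hx => ?_)
    fun x hx => ?_
  · exact contDiffAt_id.add (((hb.contDiffAt.neg.add
      (hD.contDiffAt.sqrt (hD0 x hx).ne')).div ha.contDiffAt (ha0 x).ne').smul hv.contDiffAt)
  · have : D x = b x ^ 2 := by simp [D, hx]
    simp [r, s, this, Real.sqrt_sq (hb0 x hx).le]
  · have hs2 : a x * s x ^ 2 + 2 * s x * b x = R ^ 2 - ⟪x, x⟫ := by
      have hq := Real.sq_sqrt (hD0 x hx).le
      have hsa : a x * s x = -b x + Real.sqrt (D x) := mul_div_cancel₀ _ (ha0 x).ne'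
      refine mul_left_cancel₀ (ha0 x).ne' ?_
      have : (a x * s x + b x) ^ 2 = b x ^ 2 + a x * (R ^ 2 - ⟪x, x⟫) := by
        rw [hsa, show -b x + √(D x) + b x = √(D x) by ring, hq]
      linear_combination this
    have : ‖r x‖ ^ 2 = R ^ 2 := by
      rw [← real_inner_self_eq_norm_sq]
      simp only [r, inner_add_left, inner_add_right, inner_smul_left, inner_smul_right,
        real_inner_comm x (v x)]
      simp only [a, b] at hs2
      simp only [RCLike.conj_to_real]
      linear_combination hs2
    exact (sq_eq_sq₀ (norm_nonneg _) hR0.le).1 this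

/-- A form of **Brouwer's fixed point theorem**. -/
theorem exists_fixedPoint_of_continuous_of_norm_le {f : E → E} (hf : Continuous f) {R : ℝ}
    (hR : ∀ x, ‖f x‖ ≤ R) : ∃ x, f x = x := by
  by_contra! hne
  have hR0 : 0 ≤ R := (norm_nonneg _).trans (hR 0)
  obtain ⟨x₀, -, hx₀⟩ := (isCompact_closedBall (0 : E) (R + 1)).exists_isMinOn
    ⟨0, by simpa using by linarith⟩ ((hf.dist continuous_id).continuousOn)
  have hδ : 0 < dist (f x₀) x₀ := dist_pos.2 (hne x₀)
  -- The bound 1 keeps a fixed point of `g` in the ball of radius `R + 1`; there the other bound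
  -- contradicts the minimality of `dist (f x₀) x₀`.
  obtain ⟨g, hg, hgf, -⟩ := hf.exists_contDiff_approx 1
    (ε := fun _ => min 1 (dist (f x₀) x₀)) continuous_const fun _ => lt_min one_pos hδ
  have hgR : ∀ x, ‖g x‖ < R + 1 := fun x => by
    have h1 := (hgf x).trans_le (min_le_left _ _)
    rw [dist_eq_norm] at h1
    linarith [hR x, norm_sub_norm_le (g x) (f x)]
  obtain ⟨x, hx⟩ := exists_fixedPoint_of_contDiff (by exact_mod_cast hg) hgR
  have h1 : dist (f x₀) x₀ ≤ dist (f x) x :=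
    hx₀ (by simpa using (hx ▸ hgR x).le : x ∈ closedBall (0 : E) (R + 1))
  have h2 := (hgf x).trans_le (min_le_right _ _)
  rw [hx, dist_comm] at h2
  exact h2.not_ge h1

end Brouwer

/-! ### Nash equilibria of concave games on boxes. -/

section ConcaveGame

open Set Function

/-- **Existence of a Nash equilibrium** of a game in which finitely many players choose points of
compact intervals and the payoffs are continuous, and concave in the player's own strategy. -/
theorem exists_equilibrium_of_concaveOn {ι : Type*} [Fintype ι] [DecidableEq ι] {a b : ι → ℝ}
    (hab : ∀ i, a i ≤ b i) (u : ι → (ι → ℝ) → ℝ) (hcont : ∀ i, ContinuousOn (u i) (Icc a b))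
    (hconc : ∀ i, ∀ x ∈ Icc a b, ConcaveOn ℝ (Icc (a i) (b i)) fun y => u i (update x i y)) :
    ∃ x ∈ Icc a b, ∀ i, ∀ y ∈ Icc (a i) (b i), u i (update x i y) ≤ u i x := by
  by_contra! hno
  -- Clamping to the box makes everything defined and continuous on the whole space.
  let P : (ι → ℝ) → ι → ℝ := fun x i => max (a i) (min (b i) (x i))
  have hPc : Continuous P := by fun_prop
  have hP : ∀ x, P x ∈ Icc a b := fun x =>
    ⟨fun i => le_max_left _ _, fun i => max_le (hab i) (min_le_left _ _)⟩
  have hPid : ∀ x ∈ Icc a b, P x = x := fun x hx => funext fun i => by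
    simp [P, hx.1 i, hx.2 i]
  have hupd : ∀ x ∈ Icc a b, ∀ i, ∀ y ∈ Icc (a i) (b i), update x i y ∈ Icc a b := by
    intro x hx i y hy
    exact ⟨le_update_iff.2 ⟨hy.1, fun j _ => hx.1 j⟩, update_le_iff.2 ⟨hy.2, fun j _ => hx.2 j⟩⟩
  let F : (ι → ℝ) → (ι → ℝ) → ℝ := fun x y => ∑ i, (u i (update (P x) i (y i)) - u i (P x))
  have hFconc : ∀ x, ConcaveOn ℝ (Icc a b) (F x) := by
    refine fun x => ⟨convex_Icc a b, fun y hy z hz c d hc hd hcd => ?_⟩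
    simp only [F, smul_eq_mul, Finset.mul_sum, ← Finset.sum_add_distrib]
    refine Finset.sum_le_sum fun i _ => ?_
    have h := (hconc i (P x) (hP x)).2 ⟨hy.1 i, hy.2 i⟩ ⟨hz.1 i, hz.2 i⟩ hc hd hcd
    simp only [smul_eq_mul] at h
    simp only [Pi.add_apply, Pi.smul_apply, smul_eq_mul]
    linear_combination h - (u i (P x)) * hcd
  obtain ⟨g, hg⟩ := exists_continuous_forall_mem_convex_of_local_const
    (t := fun x => {y ∈ Icc a b | 0 < F x y}) (fun x => (hFconc x).convex_gt 0) (fun x => by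
      obtain ⟨i, y, hy, hlt⟩ := hno (P x) (hP x)
      have hmem := hupd (P x) (hP x) i y hy
      refine ⟨update (P x) i y, ?_⟩
      have hpos : 0 < F x (update (P x) i y) := by
        simp only [F]
        rw [Finset.sum_eq_single i (fun j _ hj => by simp [update_of_ne hj]) (by simp)]
        simpa using hlt
      have hFc : Continuous fun x' => F x' (update (P x) i y) := by
        refine continuous_finsetSum _ fun j _ => Continuous.sub ?_ ?_
        · exact (hcont j).comp_continuous (hPc.update j continuous_const)
            fun x' => hupd _ (hP x') j _ ⟨hmem.1 j, hmem.2 j⟩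
        · exact (hcont j).comp_continuous hPc hP
      filter_upwards [hFc.continuousAt.eventually (lt_mem_nhds hpos)] with x' hx'
      exact ⟨hmem, hx'⟩)
  -- The sup norm on `ι → ℝ` is not Euclidean, so Brouwer is applied through `e`.
  let e := EuclideanSpace.equiv ι ℝ
  obtain ⟨R, hR⟩ := ((isCompact_Icc (a := a) (b := b)).image
    e.symm.continuous).isBounded.exists_norm_le
  obtain ⟨x, hx⟩ := exists_fixedPoint_of_continuous_of_norm_le (f := fun x => e.symm (g (e x)))
    (by fun_prop) (fun x => hR _ (mem_image_of_mem _ (hg (e x)).1))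
  have hx' : g (e x) = e x := by simpa using congrArg e hx
  obtain ⟨h1, h2⟩ := hg (e x)
  rw [hx'] at h1 h2
  simp [F, hPid _ h1] at h2

end ConcaveGame

/-! ### Equilibria of the privacy game. -/

namespace FLPG

open Set Function

variable {K : ℕ} {G : FLPG K}

theorem isBounded_strategy (k : Fin K) : Bornology.IsBounded (G.strategy k) := by
  by_cases h : k = G.attacker
  · subst h
    exact (Metric.isBounded_Icc _ _).subset G.strategy_attacker
  · exact (Metric.isBounded_Icc _ _).subset (G.strategy_defender k h)

theorem exists_isRobustEquilibrium (Ψ : RobustOperator)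
    (hS : ∀ k, IsClosed (G.strategy k) ∧ Convex ℝ (G.strategy k))
    (hcont : ∀ k, ContinuousOn (G.robustPayoff Ψ k) G.profiles)
    (hconc : ∀ k, ∀ s ∈ G.profiles,
      ConcaveOn ℝ (G.strategy k) fun x => G.robustPayoff Ψ k (update s k x)) :
    ∃ s, G.IsRobustEquilibrium Ψ s := by
  have hIcc : ∀ k, G.strategy k = Icc (sInf (G.strategy k)) (sSup (G.strategy k)) := fun k =>
    eq_Icc_of_connected_compact ⟨G.strategy_nonempty k, (hS k).2.isPreconnected⟩
      (Metric.isCompact_of_isClosed_isBounded (hS k).1 (isBounded_strategy k))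
  have hprof : G.profiles =
      Icc (fun k => sInf (G.strategy k)) (fun k => sSup (G.strategy k)) := by
    rw [profiles, ← pi_univ_Icc]
    exact congrArg (pi univ) (funext hIcc)
  obtain ⟨s, hs, hmax⟩ := exists_equilibrium_of_concaveOn
    (a := fun k => sInf (G.strategy k)) (b := fun k => sSup (G.strategy k))
    (fun k => nonempty_Icc.1 (hIcc k ▸ G.strategy_nonempty k)) (G.robustPayoff Ψ)
    (hprof ▸ hcont) (fun k s hs => by rw [← hIcc k]; exact hconc k s (hprof ▸ hs))
  exact ⟨s, hprof ▸ hs, fun k x hx => hmax k x (hIcc k ▸ hx)⟩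

theorem answerProb_update (p : G.FollowProbs) (k : Fin K) (q : G.strategy k → ℝ)
    (t : Fin K → Bool) (s : G.Profile) :
    answerProb (update p k q) t s = (if t k then q (s k) else 1 - q (s k)) *
      ∏ j ∈ Finset.univ.erase k, if t j then p j (s j) else 1 - p j (s j) := by
  rw [answerProb, ← Finset.mul_prod_erase _ _ (Finset.mem_univ k), update_self]
  congr 1
  refine Finset.prod_congr rfl fun j hj => ?_
  rw [update_of_ne (Finset.ne_of_mem_erase hj)]

section Correlated

variable [∀ k, Fintype (G.strategy k)] (Ψ : RobustOperator) (Po : G.Profile → ℝ)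
  (candidate : ∀ k, G.strategy k → G.strategy k)

/-- The payoff of a player is an affine function of the player's own following probabilities. -/
theorem exists_correlatedPayoff_update_eq (p : G.FollowProbs) (k : Fin K) :
    ∃ (α : ℝ) (β : G.strategy k → ℝ), ∀ q : G.strategy k → ℝ,
      G.correlatedPayoff Ψ Po candidate k (update p k q) = α + ∑ σ, β σ * q σ := by
  classical
  let w : G.Profile → (Fin K → Bool) → ℝ := fun s t =>
    (∏ j ∈ Finset.univ.erase k, if t j then p j (s j) else 1 - p j (s j)) *
      G.robustPayoff Ψ k fun j => played candidate t s j
  -- `α` is the payoff if player `k` never follows; `β σ` is the gain from following at `σ`.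
  refine ⟨∑ s, Po s * ∑ t, (if t k then 0 else 1) * w s t,
    fun σ => ∑ s : G.Profile with s k = σ, Po s * ∑ t, (if t k then 1 else -1) * w s t,
    fun q => ?_⟩
  have h : ∀ σ, (∑ s : G.Profile with s k = σ, Po s * ∑ t, (if t k then 1 else -1) * w s t) * q σ
      = ∑ s : G.Profile with s k = σ, Po s * (∑ t, (if t k then 1 else -1) * w s t) * q (s k) := by
    intro σ
    rw [Finset.sum_mul]
    refine Finset.sum_congr rfl fun s hs => ?_
    rw [(Finset.mem_filter.1 hs).2]
  simp only [h]
  rw [Finset.sum_fiberwise, ← Finset.sum_add_distrib, correlatedPayoff]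
  refine Finset.sum_congr rfl fun s _ => ?_
  rw [mul_assoc, ← mul_add, Finset.sum_mul, ← Finset.sum_add_distrib]
  congr 1
  refine Finset.sum_congr rfl fun t _ => ?_
  rw [answerProb_update, mul_assoc]
  simp only [w]
  split_ifs <;> ring

theorem continuous_correlatedPayoff (k : Fin K) :
    Continuous (G.correlatedPayoff Ψ Po candidate k) := by
  unfold correlatedPayoff answerProb
  refine continuous_finsetSum _ fun s _ => continuous_const.mul <|
    continuous_finsetSum _ fun t _ => Continuous.mul ?_ continuous_const
  refine continuous_finsetProd _ fun j _ => ?_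
  split_ifs <;> fun_prop

/-- Each drawn profile contains a single suggestion to player `k`, so the payoff has no cross terms
between the player's own following probabilities. Optimality in each coordinate thus adds up to
optimality of the whole vector. -/
theorem exists_isRobustCorrelatedEquilibrium :
    ∃ p, G.IsRobustCorrelatedEquilibrium Ψ Po candidate p := by
  classical
  let p : ((Σ k, G.strategy k) → ℝ) → G.FollowProbs := fun x k σ => x ⟨k, σ⟩
  have hpu : ∀ x k σ y, p (update x ⟨k, σ⟩ y) = update (p x) k (update (p x k) σ y) := by
    intro x k σ y
    exact Sigma.curry_update (γ := fun k (_ : G.strategy k) => ℝ) ⟨k, σ⟩ x y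
  have hself : ∀ x k, update (p x) k (p x k) = p x := fun x k => update_eq_self k (p x)
  have haff : ∀ (k : Fin K) (β f : G.strategy k → ℝ) (σ : G.strategy k) (y : ℝ),
      ∑ τ, β τ * update f σ y τ = ∑ τ, β τ * f τ + β σ * (y - f σ) := by
    intro k β f σ y
    rw [← sub_eq_iff_eq_add', ← Finset.sum_sub_distrib, Finset.sum_eq_single σ
      (fun τ _ hτ => by rw [update_of_ne hτ, sub_self]) (by simp), update_self, mul_sub]
  obtain ⟨x, hx, hmax⟩ := exists_equilibrium_of_concaveOn (ι := Σ k, G.strategy k)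
    (a := 0) (b := 1) (fun _ => zero_le_one)
    (fun i x => G.correlatedPayoff Ψ Po candidate i.1 (p x))
    (fun i => ((continuous_correlatedPayoff Ψ Po candidate i.1).comp
      (by fun_prop)).continuousOn)
    (fun ⟨k, σ⟩ x _ => by
      obtain ⟨α, β, h⟩ := exists_correlatedPayoff_update_eq Ψ Po candidate (p x) k
      simp only [hpu, h, haff]
      refine ⟨convex_Icc _ _, fun y _ z _ c d _ _ hcd => le_of_eq ?_⟩
      simp only [smul_eq_mul]
      linear_combination (α + ∑ τ, β τ * p x k τ - β σ * p x k σ) * hcd)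
  refine ⟨p x, fun k σ => ⟨hx.1 ⟨k, σ⟩, hx.2 ⟨k, σ⟩⟩, fun k q hq => ?_⟩
  obtain ⟨α, β, h⟩ := exists_correlatedPayoff_update_eq Ψ Po candidate (p x) k
  have hx' : G.correlatedPayoff Ψ Po candidate k (p x) = α + ∑ σ, β σ * p x k σ := by
    rw [← h, hself]
  rw [h, hx']
  refine add_le_add_right (Finset.sum_le_sum fun σ _ => ?_) α
  have hσ := hmax ⟨k, σ⟩ (q σ) (hq σ)
  simp only [hpu, h, haff, hx'] at hσ
  linarith

end Correlated

end FLPG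

theorem mainTheorem1 (K : ℕ) (G : FLPG K) (Ψ : RobustOperator) :
    ((∀ k, IsClosed (G.strategy k) ∧ Convex ℝ (G.strategy k)) →
      (∀ k, ContinuousOn (G.robustPayoff Ψ k) G.profiles) →
      (∀ k, ∀ s ∈ G.profiles,
        ConcaveOn ℝ (G.strategy k) fun x => G.robustPayoff Ψ k (Function.update s k x)) →
      ∃ s, G.IsRobustEquilibrium Ψ s) ∧
    (∀ [∀ k, Fintype (G.strategy k)], ∀ Po ∈ stdSimplex ℝ G.Profile,
      ∀ candidate : ∀ k, G.strategy k → G.strategy k,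
      (∀ k, G.BoundedUncertainty k) →
      ∃ p, G.IsRobustCorrelatedEquilibrium Ψ Po candidate p) :=
  ⟨G.exists_isRobustEquilibrium Ψ, fun Po _ candidate _ =>
    G.exists_isRobustCorrelatedEquilibrium Ψ Po candidate⟩
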